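/- Let $\mathcal{F}^2$ be the Fock space, i.e. the Hilbert space of all entire functions $f$ on $\mathbb{C}$ that are square integrable with respect to $d\mu(z)=\pi^{-1}e^{-|z|^2}\,dA(z)$ ($dA$ being Lebesgue area measure), with inner product $\langle f,g\rangle=\int_{\mathbb{C}} f\,\overline{g}\,d\mu$. For $w\in\mathbb{C}$ let $K_w(z)=e^{\bar w z}$ be its reproducing kernel function. Let $\psi$ be an entire function that is not identically zero, and let $\varphi(z)=az+b$ with $a,b\in\mathbb{C}$ and $|a|<1$. Let $C_{\psi,\varphi}$ be the weighted composition operator $C_{\psi,\varphi}f=\psi\cdot(f\circ\varphi)$, $f\in\mathcal{F}^2$. Call a bounded operator $T$ normaloid if its norm $\|T\|$ equals its spectral radius $r(T)$. Then $C_{\psi,\varphi}$ is a (well-defined, bounded) operator on $\mathcal{F}^2$ that is compact and normaloid if and only if $$\psi=\psi(0)\,K_{b\frac{\bar a-1}{a-1}} .$$ -/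

import Mathlib

open MeasureTheory ComplexConjugate
open scoped ENNReal

noncomputable section

/-- The Gaussian measure `dμ(z) = π⁻¹ e^{-|z|²} dA(z)` on `ℂ`, with `dA` Lebesgue area measure. -/
def fockMeasure : Measure ℂ :=
  (volume : Measure ℂ).withDensity
    (fun z => ENNReal.ofReal (Real.pi⁻¹ * Real.exp (-‖z‖ ^ 2)))

theorem volume_absolutelyContinuous_fockMeasure : (volume : Measure ℂ) ≪ fockMeasure := by
  refine withDensity_absolutelyContinuous' (by fun_prop) (Filter.Eventually.of_forall fun z => ?_)
  have : 0 < Real.pi⁻¹ * Real.exp (-‖z‖ ^ 2) := by positivity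
  simpa using this

/-- The entire functions that are square integrable for the Gaussian measure. -/
def fockSubmodule : Submodule ℂ (ℂ → ℂ) where
  carrier := {f | Differentiable ℂ f ∧ MemLp f 2 fockMeasure}
  add_mem' hf hg := ⟨hf.1.add hg.1, hf.2.add hg.2⟩
  zero_mem' := ⟨differentiable_const 0, MemLp.zero'⟩
  smul_mem' c _ hf := ⟨hf.1.const_smul c, hf.2.const_smul c⟩

/-- The Fock space `𝓕²`. It is a type synonym of the submodule of functions, so that it does not
inherit the topology of pointwise convergence; its topology is the one of the norm below. -/
def FockSpace : Type := fockSubmodule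

namespace FockSpace

instance : AddCommGroup FockSpace := inferInstanceAs (AddCommGroup fockSubmodule)

instance : Module ℂ FockSpace := inferInstanceAs (Module ℂ fockSubmodule)

instance : CoeFun FockSpace (fun _ => ℂ → ℂ) := ⟨fun f => f.val⟩

theorem differentiable (f : FockSpace) : Differentiable ℂ f := f.property.1

theorem memLp (f : FockSpace) : MemLp f 2 fockMeasure := f.property.2

theorem add_apply (f g : FockSpace) (z : ℂ) : (f + g) z = f z + g z := rfl

theorem smul_apply (c : ℂ) (f : FockSpace) (z : ℂ) : (c • f) z = c * f z := rfl

theorem integrable_conj_mul (f g : FockSpace) :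
    Integrable (fun z => conj (f z) * g z) fockMeasure :=
  MemLp.integrable_mul (p := 2) (q := 2) f.memLp.star g.memLp

/-- The inner product `⟪f, g⟫ = ∫ conj (f z) g z dμ(z)`, conjugate-linear in the first variable as
everywhere in Mathlib. -/
abbrev innerCore : InnerProductSpace.Core ℂ FockSpace where
  inner f g := ∫ z, conj (f z) * g z ∂fockMeasure
  conj_inner_symm f g := by
    rw [← integral_conj]
    refine integral_congr_ae (Filter.Eventually.of_forall fun z => ?_)
    simp [mul_comm]
  re_inner_nonneg f := by
    have h : (fun z => conj (f z) * f z) = fun z => ((‖f z‖ ^ 2 : ℝ) : ℂ) := by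
      funext z
      rw [RCLike.conj_mul]
      push_cast
      rfl
    rw [h, integral_complex_ofReal]
    exact integral_nonneg fun z => by positivity
  add_left f g h := by
    rw [← integral_add (integrable_conj_mul f h) (integrable_conj_mul g h)]
    refine integral_congr_ae (Filter.Eventually.of_forall fun z => ?_)
    simp [add_apply, add_mul]
  smul_left f g c := by
    rw [← integral_const_mul]
    refine integral_congr_ae (Filter.Eventually.of_forall fun z => ?_)
    simp [smul_apply, mul_assoc]
  definite f hf := by
    have h : (fun z => conj (f z) * f z) = fun z => ((‖f z‖ ^ 2 : ℝ) : ℂ) := by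
      funext z
      rw [RCLike.conj_mul]
      push_cast
      rfl
    rw [h, integral_complex_ofReal] at hf
    have hf' : ∫ z, ‖f z‖ ^ 2 ∂fockMeasure = 0 := by exact_mod_cast hf
    have hint : Integrable (fun z => ‖f z‖ ^ 2) fockMeasure := f.memLp.norm.integrable_sq
    rw [integral_eq_zero_iff_of_nonneg (fun z => by positivity) hint] at hf'
    have h0 : f.val =ᵐ[volume] fun _ => (0 : ℂ) := by
      filter_upwards [volume_absolutelyContinuous_fockMeasure.ae_le hf'] with z hz
      simpa using hz
    apply Subtype.ext
    exact Continuous.ae_eq_iff_eq volume f.differentiable.continuous continuous_const |>.1 h0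

instance : NormedAddCommGroup FockSpace := innerCore.toNormedAddCommGroup

instance : InnerProductSpace ℂ FockSpace := InnerProductSpace.ofCore innerCore.toCore

end FockSpace

/-- The reproducing kernel function `K_w(z) = e^{conj(w) z}`. -/
def fockKernel (w z : ℂ) : ℂ := Complex.exp (conj w * z)

/-- The weighted composition `f ↦ ψ · (f ∘ φ)`. -/
def weightedComp (ψ φ f : ℂ → ℂ) : ℂ → ℂ := fun z => ψ z * f (φ z)

/-- The bounded operator `T` on the Fock space is `C_{ψ,φ}`: it sends every `f` to `ψ · (f ∘ φ)`.
There is at most one such `T`, and there is one exactly if `C_{ψ,φ}` maps the Fock space into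
itself and is bounded. -/
def IsWeightedCompositionOperator (ψ φ : ℂ → ℂ) (T : FockSpace →L[ℂ] FockSpace) : Prop :=
  ∀ f : FockSpace, (T f : ℂ → ℂ) = weightedComp ψ φ f

/-- A bounded operator is normaloid if its norm equals its spectral radius. -/
def IsNormaloid {E : Type*} [NormedAddCommGroup E] [NormedSpace ℂ E] (T : E →L[ℂ] E) : Prop :=
  (‖T‖₊ : ℝ≥0∞) = spectralRadius ℂ T

end

/-! Since `a ≠ 1`, the symbol has the fixed point `p = b / (1 - a)` and reads `z ↦ a (z - p) + p`;
the kernel in the statement is `exp (conj p * (1 - a) * z)`.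

If `T` is compact, each nonzero spectral value is an eigenvalue, and comparing leading Taylor
coefficients at `p` shows that it equals `ψ p * a ^ n`. Hence `r(T) ≤ |ψ p|` (`spectralRadius_le`),
and normaloid forces `‖T‖ ≤ |ψ p|`. But `⟪K_p, T K_p⟫ = ψ p * ‖K_p‖²`, so Cauchy–Schwarz is an
equality and `T K_p = ψ p • K_p` (`eq_of_map_kernel`); solving this for `ψ` gives the formula.

Conversely, for such a `ψ` the operator is `ψ p` times a dilation `f ↦ f (a ·)` conjugated by Weyl
translations. These are isometries, and the dilation is a compact contraction, so `T` is compact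
with `‖T‖ ≤ |ψ p|`. Then `K_p` is again an eigenvector, and `‖T‖ ≤ |ψ p| ≤ r(T) ≤ ‖T‖`. -/

noncomputable section

/-! ### Gaussian measures and the mean value property -/

/-- The density of the centred complex Gaussian distribution with `𝔼 |Z|² = t`. -/
def gaussianDensity (t : ℝ) (z : ℂ) : ℝ := (Real.pi * t)⁻¹ * Real.exp (-‖z‖ ^ 2 / t)

@[fun_prop]
theorem continuous_gaussianDensity (t : ℝ) : Continuous (gaussianDensity t) := by
  unfold gaussianDensity
  fun_prop

theorem gaussianDensity_nonneg {t : ℝ} (ht : 0 < t) (z : ℂ) : 0 ≤ gaussianDensity t z := by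
  unfold gaussianDensity
  positivity

theorem integral_exp_neg_mul_norm_sq {s : ℝ} (hs : 0 < s) :
    ∫ z : ℂ, Real.exp (-s * ‖z‖ ^ 2) = Real.pi / s := by
  simpa using GaussianFourier.integral_rexp_neg_mul_sq_norm (V := ℂ) hs

theorem integrable_exp_neg_mul_norm_sq {s : ℝ} (hs : 0 < s) :
    Integrable fun z : ℂ => Real.exp (-s * ‖z‖ ^ 2) := by
  refine Integrable.of_integral_ne_zero ?_
  rw [integral_exp_neg_mul_norm_sq hs]
  positivity

theorem gaussianDensity_eq (t : ℝ) :
    gaussianDensity t = fun z => (Real.pi * t)⁻¹ * Real.exp (-t⁻¹ * ‖z‖ ^ 2) := by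
  funext z
  rw [gaussianDensity]
  ring_nf

theorem integrable_gaussianDensity {t : ℝ} (ht : 0 < t) : Integrable (gaussianDensity t) := by
  rw [gaussianDensity_eq]
  exact (integrable_exp_neg_mul_norm_sq (inv_pos.2 ht)).const_mul _

theorem integral_gaussianDensity {t : ℝ} (ht : 0 < t) : ∫ z, gaussianDensity t z = 1 := by
  rw [gaussianDensity_eq, integral_const_mul, integral_exp_neg_mul_norm_sq (inv_pos.2 ht)]
  field_simp

theorem lintegral_gaussianDensity {t : ℝ} (ht : 0 < t) :
    ∫⁻ z, ENNReal.ofReal (gaussianDensity t z) = 1 := by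
  rw [← ofReal_integral_eq_lintegral_ofReal (integrable_gaussianDensity ht)
    (Filter.Eventually.of_forall (gaussianDensity_nonneg ht)), integral_gaussianDensity ht,
    ENNReal.ofReal_one]

/-- The centred complex Gaussian distribution with `𝔼 |Z|² = t`. -/
def complexGaussian (t : ℝ) : Measure ℂ :=
  volume.withDensity fun z => ENNReal.ofReal (gaussianDensity t z)

theorem fockMeasure_eq_complexGaussian : fockMeasure = complexGaussian 1 := by
  simp [fockMeasure, complexGaussian, gaussianDensity]

theorem isProbabilityMeasure_complexGaussian {t : ℝ} (ht : 0 < t) :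
    IsProbabilityMeasure (complexGaussian t) :=
  ⟨by rw [complexGaussian, withDensity_apply _ MeasurableSet.univ, setLIntegral_univ,
    lintegral_gaussianDensity ht]⟩

instance : IsProbabilityMeasure fockMeasure := by
  rw [fockMeasure_eq_complexGaussian]
  exact isProbabilityMeasure_complexGaussian one_pos

theorem integral_complexGaussian {t : ℝ} (ht : 0 < t) (h : ℂ → ℂ) :
    ∫ z, h z ∂complexGaussian t = ∫ z, (gaussianDensity t z : ℂ) * h z := by
  rw [complexGaussian, integral_withDensity_eq_integral_toReal_smul (by fun_prop)
    (Filter.Eventually.of_forall fun _ => ENNReal.ofReal_lt_top)]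
  refine integral_congr_ae (Filter.Eventually.of_forall fun z => ?_)
  simp [ENNReal.toReal_ofReal (gaussianDensity_nonneg ht z)]

theorem lintegral_complexGaussian (t : ℝ) {g : ℂ → ℝ≥0∞} (hg : Measurable g) :
    ∫⁻ z, g z ∂complexGaussian t = ∫⁻ z, ENNReal.ofReal (gaussianDensity t z) * g z := by
  rw [complexGaussian, lintegral_withDensity_eq_lintegral_mul _ (by fun_prop) hg]
  rfl

theorem measurePreserving_mul_complexGaussian (t : ℝ) {c : ℂ} (hc : ‖c‖ = 1) :
    MeasurePreserving (fun z => c * z) (complexGaussian t) (complexGaussian t) := by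
  have hv : MeasurePreserving (fun z : ℂ => c * z) volume volume :=
    (rotation ⟨c, by simpa [Submonoid.unitSphere] using hc⟩).measurePreserving
  refine ⟨by fun_prop, ?_⟩
  refine Measure.ext_of_lintegral _ fun g hg => ?_
  rw [lintegral_map hg (by fun_prop), lintegral_complexGaussian _ hg,
    lintegral_complexGaussian _ (by fun_prop),
    ← hv.lintegral_comp (f := fun z => ENNReal.ofReal (gaussianDensity t z) * g z) (by fun_prop)]
  simp [gaussianDensity, hc]

/-- The mean value property with respect to a Gaussian distribution. -/
theorem integral_complexGaussian_eq_apply_zero {t : ℝ} (ht : 0 < t) {h : ℂ → ℂ}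
    (hd : Differentiable ℂ h) (hi : Integrable h (complexGaussian t)) :
    ∫ z, h z ∂complexGaussian t = h 0 := by
  have := isProbabilityMeasure_complexGaussian ht
  -- Rotations preserve the measure, so `h` may be averaged over circles about `0` first; there the
  -- classical mean value property applies.
  let F : ℝ × ℂ → ℂ := fun q => h (circleMap 0 1 q.1 * q.2)
  have hrot : ∀ θ : ℝ, MeasurePreserving (fun z => circleMap 0 1 θ * z) (complexGaussian t)
      (complexGaussian t) := fun θ => measurePreserving_mul_complexGaussian t (by simp)
  have hF : Continuous F := by
    have := hd.continuous
    fun_prop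
  have hFi : Integrable F ((volume.restrict (Set.Ioc 0 (2 * Real.pi))).prod (complexGaussian t)) := by
    rw [integrable_prod_iff hF.aestronglyMeasurable]
    refine ⟨Filter.Eventually.of_forall fun θ => (hrot θ).integrable_comp_of_integrable hi, ?_⟩
    have : (fun θ : ℝ => ∫ z, ‖F (θ, z)‖ ∂complexGaussian t) =
        fun _ => ∫ z, ‖h z‖ ∂complexGaussian t := by
      funext θ
      exact ((hrot θ).integral_comp' (f := MeasurableEquiv.mulLeft₀ _ (by simp)) (fun z => ‖h z‖))
    rw [this]
    exact integrable_const _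
  have h1 := integral_integral_swap (f := fun θ z => F (θ, z)) hFi
  have h2 : ∀ θ : ℝ, ∫ z, F (θ, z) ∂complexGaussian t = ∫ z, h z ∂complexGaussian t := fun θ =>
    (hrot θ).integral_comp' (f := MeasurableEquiv.mulLeft₀ _ (by simp)) h
  have h3 : ∀ z : ℂ, ∫ θ in Set.Ioc 0 (2 * Real.pi), F (θ, z) = (2 * Real.pi : ℝ) • h 0 := by
    intro z
    have hk : Differentiable ℂ fun ζ : ℂ => h (ζ * z) := by fun_prop
    have := DiffContOnCl.circleAverage (c := 0) (R := 1) hk.diffContOnCl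
    rw [Real.circleAverage_def, zero_mul,
      intervalIntegral.integral_of_le (by positivity), inv_smul_eq_iff₀ (by positivity)] at this
    exact this
  simp only [h2, h3, integral_const, smul_smul] at h1
  have hpi : (0 : ℝ) < 2 * Real.pi := by positivity
  simp only [measureReal_restrict_apply_univ, Real.volume_real_Ioc_of_le hpi.le, sub_zero,
    probReal_univ, one_mul] at h1
  exact smul_right_injective ℂ hpi.ne' h1

theorem enorm_sq_apply_zero_le_lintegral {t : ℝ} (ht : 0 < t) {h : ℂ → ℂ}
    (hd : Differentiable ℂ h) : ‖h 0‖ₑ ^ 2 ≤ ∫⁻ z, ‖h z‖ₑ ^ 2 ∂complexGaussian t := by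
  have := isProbabilityMeasure_complexGaussian ht
  have hsm : AEStronglyMeasurable h (complexGaussian t) := hd.continuous.aestronglyMeasurable
  have hL : eLpNorm h 2 (complexGaussian t) ^ 2 = ∫⁻ z, ‖h z‖ₑ ^ 2 ∂complexGaussian t := by
    simpa using eLpNorm_nnreal_pow_eq_lintegral (f := h) (μ := complexGaussian t) (p := 2) (by simp)
  by_cases htop : eLpNorm h 2 (complexGaussian t) = ⊤
  · simp [← hL, htop]
  have hm : MemLp h 2 (complexGaussian t) := ⟨hsm, lt_top_iff_ne_top.2 htop⟩
  rw [← hL, ← integral_complexGaussian_eq_apply_zero ht hd (hm.integrable (by norm_num))]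
  gcongr
  calc _ ≤ ∫⁻ z, ‖h z‖ₑ ∂complexGaussian t := enorm_integral_le_lintegral_enorm _
    _ = eLpNorm h 1 (complexGaussian t) := eLpNorm_one_eq_lintegral_enorm.symm
    _ ≤ _ := eLpNorm_le_eLpNorm_of_exponent_le (by norm_num) hsm

/-- Bayes' rule: if `Z` and `V` are independent centred Gaussians of variances `1` and `t`, then `U
= a Z + V` has variance `1`, and given `U = u` the law of `Z` is Gaussian with mean `conj a * u` and
variance `t`. -/
theorem gaussianDensity_mul_gaussianDensity {a : ℂ} {t : ℝ} (ht : 0 < t) (hat : t = 1 - ‖a‖ ^ 2)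
    (z u : ℂ) : gaussianDensity 1 z * gaussianDensity t (u - a * z) =
      gaussianDensity 1 u * gaussianDensity t (z - conj a * u) := by
  have key : ‖z‖ ^ 2 + ‖u - a * z‖ ^ 2 / t = ‖u‖ ^ 2 + ‖z - conj a * u‖ ^ 2 / t := by
    have h1 : ‖u - a * z‖ ^ 2 - ‖z - conj a * u‖ ^ 2 = t * (‖u‖ ^ 2 - ‖z‖ ^ 2) := by
      rw [hat]
      simp only [← Complex.normSq_eq_norm_sq, Complex.normSq_apply, Complex.sub_re, Complex.sub_im,
        Complex.mul_re, Complex.mul_im, Complex.conj_re, Complex.conj_im]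
      ring
    have h2 := congrArg (· / t) h1
    simp only [sub_div, mul_div_cancel_left₀ _ ht.ne'] at h2
    linarith
  simp only [gaussianDensity]
  rw [mul_mul_mul_comm _ (Real.exp (-‖z‖ ^ 2 / 1)), mul_mul_mul_comm _ (Real.exp (-‖u‖ ^ 2 / 1)),
    ← Real.exp_add, ← Real.exp_add]
  congr 2
  rw [neg_div, neg_div, neg_div, neg_div, div_one, div_one]
  linarith

/-- The dilations `f ↦ f (a ·)` with `|a| < 1` contract the norm of the Fock space. -/
theorem lintegral_enorm_sq_comp_mul_le {a : ℂ} (ha : ‖a‖ < 1) {g : ℂ → ℂ}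
    (hg : Differentiable ℂ g) :
    ∫⁻ z, ‖g (a * z)‖ₑ ^ 2 ∂fockMeasure ≤ ∫⁻ z, ‖g z‖ₑ ^ 2 ∂fockMeasure := by
  obtain ⟨t, hat⟩ : ∃ t, t = 1 - ‖a‖ ^ 2 := ⟨_, rfl⟩
  have ht : 0 < t := by
    rw [hat]
    nlinarith [norm_nonneg a]
  have hgm : Measurable g := hg.continuous.measurable
  let G : ℝ → ℂ → ℝ≥0∞ := fun s z => ENNReal.ofReal (gaussianDensity s z)
  have hG : ∀ s, Measurable (G s) := fun s => by fun_prop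
  rw [fockMeasure_eq_complexGaussian, lintegral_complexGaussian _ (by fun_prop),
    lintegral_complexGaussian _ (by fun_prop)]
  -- The value `g (a z)` is a Gaussian mean of `g (a z + v)`. The variance `t` makes `a Z + V`
  -- distributed like `Z`, so averaging over `z` returns the norm of `g`.
  calc ∫⁻ z, G 1 z * ‖g (a * z)‖ₑ ^ 2
      ≤ ∫⁻ z, G 1 z * ∫⁻ v, G t v * ‖g (v + a * z)‖ₑ ^ 2 := by
        refine lintegral_mono fun z => mul_le_mul_right ?_ _
        have := enorm_sq_apply_zero_le_lintegral ht (h := fun v => g (v + a * z)) (by fun_prop)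
        rwa [zero_add, lintegral_complexGaussian _ (by fun_prop)] at this
    _ = ∫⁻ z, ∫⁻ u, G 1 z * (G t (u - a * z) * ‖g u‖ₑ ^ 2) := by
        refine lintegral_congr fun z => ?_
        rw [lintegral_const_mul _ (by fun_prop),
          ← lintegral_add_right_eq_self (fun u => G t (u - a * z) * ‖g u‖ₑ ^ 2) (a * z)]
        simp
    _ = ∫⁻ u, ∫⁻ z, G 1 z * (G t (u - a * z) * ‖g u‖ₑ ^ 2) := by
        refine lintegral_lintegral_swap ?_
        have := hG 1
        have := hG t
        fun_prop
    _ = ∫⁻ u, ∫⁻ z, G 1 u * ‖g u‖ₑ ^ 2 * G t (z - conj a * u) := by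
        refine lintegral_congr fun u => lintegral_congr fun z => ?_
        have := congrArg ENNReal.ofReal (gaussianDensity_mul_gaussianDensity ht hat z u)
        rw [ENNReal.ofReal_mul (gaussianDensity_nonneg one_pos _),
          ENNReal.ofReal_mul (gaussianDensity_nonneg one_pos _)] at this
        rw [← mul_assoc, this, mul_right_comm]
    _ = ∫⁻ u, G 1 u * ‖g u‖ₑ ^ 2 := by
        refine lintegral_congr fun u => ?_
        rw [lintegral_const_mul _ (by fun_prop), lintegral_sub_right_eq_self (G t),
          lintegral_gaussianDensity ht, mul_one]

/-! ### Weyl translations -/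

/-- The Weyl translation `f ↦ f (· + p) · e^{-conj p · - |p|²/2}`. -/
def weylShift (p : ℂ) (f : ℂ → ℂ) (u : ℂ) : ℂ :=
  f (u + p) * Complex.exp (-conj p * u - ‖p‖ ^ 2 / 2)

theorem differentiable_weylShift (p : ℂ) {f : ℂ → ℂ} (hf : Differentiable ℂ f) :
    Differentiable ℂ (weylShift p f) := by
  unfold weylShift
  fun_prop

theorem norm_weylShift (p : ℂ) (f : ℂ → ℂ) (u : ℂ) :
    ‖weylShift p f u‖ = ‖f (u + p)‖ * Real.exp ((‖u‖ ^ 2 - ‖u + p‖ ^ 2) / 2) := by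
  rw [weylShift, norm_mul, Complex.norm_exp]
  congr 2
  simp only [← Complex.ofReal_pow, ← Complex.normSq_eq_norm_sq, Complex.normSq_apply]
  simp
  ring

theorem lintegral_enorm_sq_weylShift (p : ℂ) {f : ℂ → ℂ} (hf : Continuous f) :
    ∫⁻ z, ‖weylShift p f z‖ₑ ^ 2 ∂fockMeasure = ∫⁻ z, ‖f z‖ₑ ^ 2 ∂fockMeasure := by
  have hw : Continuous (weylShift p f) := by
    unfold weylShift
    fun_prop
  rw [fockMeasure_eq_complexGaussian, lintegral_complexGaussian _ (by fun_prop),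
    lintegral_complexGaussian _ (by fun_prop),
    ← lintegral_add_right_eq_self (fun z => _ * ‖f z‖ₑ ^ 2) p]
  refine lintegral_congr fun u => ?_
  rw [← ofReal_norm, ← ofReal_norm, ← ENNReal.ofReal_pow (norm_nonneg _),
    ← ENNReal.ofReal_pow (norm_nonneg _), ← ENNReal.ofReal_mul (gaussianDensity_nonneg one_pos _),
    ← ENNReal.ofReal_mul (gaussianDensity_nonneg one_pos _), norm_weylShift, mul_pow]
  have key : Real.exp (-‖u‖ ^ 2 / 1) * Real.exp ((‖u‖ ^ 2 - ‖u + p‖ ^ 2) / 2) ^ 2 =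
      Real.exp (-‖u + p‖ ^ 2 / 1) := by
    rw [← Real.exp_nat_mul, ← Real.exp_add]
    push_cast
    ring_nf
  rw [gaussianDensity, gaussianDensity, ← key]
  ring_nf

/-! ### Reproducing kernel and completeness -/

namespace FockSpace

open Filter Topology

theorem ext {f g : FockSpace} (h : ∀ z, f z = g z) : f = g :=
  Subtype.ext (funext h)

theorem continuous (f : FockSpace) : Continuous f := f.differentiable.continuous

theorem sub_apply (f g : FockSpace) (z : ℂ) : (f - g) z = f z - g z := rfl

theorem inner_eq_integral (f g : FockSpace) :
    inner ℂ f g = ∫ z, conj (f z) * g z ∂fockMeasure := rfl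

theorem norm_sq_eq_integral (f : FockSpace) : ‖f‖ ^ 2 = ∫ z, ‖f z‖ ^ 2 ∂fockMeasure := by
  have h : inner ℂ f f = ((∫ z, ‖f z‖ ^ 2 ∂fockMeasure : ℝ) : ℂ) := by
    rw [inner_eq_integral, ← integral_complex_ofReal]
    refine integral_congr_ae (Eventually.of_forall fun z => ?_)
    simp only [Complex.conj_mul', Complex.ofReal_pow]
  rw [inner_self_eq_norm_sq_to_K] at h
  exact Complex.ofReal_injective ((Complex.ofReal_pow _ _).trans h)

theorem enorm_sq_eq_lintegral (f : FockSpace) :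
    ‖f‖ₑ ^ 2 = ∫⁻ z, ‖f z‖ₑ ^ 2 ∂fockMeasure := by
  have hi : Integrable (fun z => ‖f z‖ ^ 2) fockMeasure := f.memLp.norm.integrable_sq
  rw [← ofReal_norm, ← ENNReal.ofReal_pow (norm_nonneg _), norm_sq_eq_integral,
    ofReal_integral_eq_lintegral_ofReal hi (Eventually.of_forall fun z => by positivity)]
  refine lintegral_congr fun z => ?_
  rw [ENNReal.ofReal_pow (norm_nonneg _), ofReal_norm]

theorem eLpNorm_sq_eq_lintegral (f : ℂ → ℂ) :
    eLpNorm f 2 fockMeasure ^ 2 = ∫⁻ z, ‖f z‖ₑ ^ 2 ∂fockMeasure := by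
  simpa using eLpNorm_nnreal_pow_eq_lintegral (f := f) (μ := fockMeasure) (p := 2) (by simp)

theorem memLp_of_lintegral_le (g : FockSpace) {f : ℂ → ℂ} (hf : Continuous f)
    (h : ∫⁻ z, ‖f z‖ₑ ^ 2 ∂fockMeasure ≤ ∫⁻ z, ‖g z‖ₑ ^ 2 ∂fockMeasure) :
    MemLp f 2 fockMeasure := by
  refine ⟨hf.aestronglyMeasurable, lt_top_iff_ne_top.2 fun htop => ?_⟩
  rw [← eLpNorm_sq_eq_lintegral, htop, ← enorm_sq_eq_lintegral] at h
  simp at h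

theorem norm_le_of_lintegral_le {f g : FockSpace}
    (h : ∫⁻ z, ‖f z‖ₑ ^ 2 ∂fockMeasure ≤ ∫⁻ z, ‖g z‖ₑ ^ 2 ∂fockMeasure) : ‖f‖ ≤ ‖g‖ := by
  rw [← enorm_sq_eq_lintegral, ← enorm_sq_eq_lintegral] at h
  exact enorm_le_iff_norm_le.1 ((ENNReal.pow_le_pow_left_iff two_ne_zero).1 h)

/-- The Weyl translations are isometries of the Fock space. -/
def weylIsometry (p : ℂ) : FockSpace →ₗᵢ[ℂ] FockSpace where
  toFun f := ⟨weylShift p f, differentiable_weylShift p f.differentiable,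
    memLp_of_lintegral_le f (differentiable_weylShift p f.differentiable).continuous
      (lintegral_enorm_sq_weylShift p f.continuous).le⟩
  map_add' f g := ext fun _ => add_mul (f _) (g _) _
  map_smul' c f := ext fun _ => mul_assoc c (f _) _
  norm_map' f := le_antisymm
    (norm_le_of_lintegral_le (lintegral_enorm_sq_weylShift p f.continuous).le)
    (norm_le_of_lintegral_le (lintegral_enorm_sq_weylShift p f.continuous).ge)

theorem weylIsometry_apply (p : ℂ) (f : FockSpace) (z : ℂ) :
    weylIsometry p f z = weylShift p f z := rfl

/-- The constant function `1`. -/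
def one : FockSpace := ⟨fun _ => 1, differentiable_const 1, memLp_const 1⟩

/-- The reproducing kernel functions as elements of the Fock space. -/
def kernel (w : ℂ) : FockSpace := Complex.exp (‖w‖ ^ 2 / 2) • weylIsometry (-w) one

theorem kernel_apply (w z : ℂ) : kernel w z = fockKernel w z := by
  rw [kernel, smul_apply, weylIsometry_apply, weylShift, fockKernel]
  change _ * (1 * _) = _
  rw [one_mul, ← Complex.exp_add]
  simp

/-- Translating the integral by `w` turns it into a multiple of the Gaussian mean of the Weyl
translate of `f`, which is the value of that translate at `0`. -/
theorem inner_kernel (w : ℂ) (f : FockSpace) : inner ℂ (kernel w) f = f w := by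
  have h0 := integral_complexGaussian_eq_apply_zero one_pos
    (weylIsometry w f).differentiable (by
      rw [← fockMeasure_eq_complexGaussian]
      exact (weylIsometry w f).memLp.integrable (by norm_num))
  rw [integral_complexGaussian one_pos] at h0
  rw [inner_eq_integral, fockMeasure_eq_complexGaussian, integral_complexGaussian one_pos,
    ← integral_add_right_eq_self _ w]
  have h1 : ∀ u, (gaussianDensity 1 (u + w) : ℂ) * (conj (kernel w (u + w)) * f (u + w)) =
      Complex.exp (‖w‖ ^ 2 / 2) * ((gaussianDensity 1 u : ℂ) * weylIsometry w f u) := by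
    intro u
    have hn : ∀ x : ℂ, (‖x‖ : ℂ) ^ 2 = conj x * x := fun x => (Complex.conj_mul' x).symm
    have key : Complex.exp (-(‖u + w‖ : ℂ) ^ 2) * Complex.exp (w * conj (u + w)) =
        Complex.exp (‖w‖ ^ 2 / 2) * (Complex.exp (-(‖u‖ : ℂ) ^ 2) *
          Complex.exp (-conj w * u - ‖w‖ ^ 2 / 2)) := by
      simp only [← Complex.exp_add, hn, map_add]
      ring_nf
    rw [kernel_apply, fockKernel, weylIsometry_apply, weylShift, gaussianDensity, gaussianDensity,
      ← Complex.exp_conj]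
    simp only [map_mul, Complex.conj_conj]
    push_cast
    rw [div_one, div_one]
    linear_combination ((Real.pi : ℂ) * 1)⁻¹ * f (u + w) * key
  simp only [h1]
  rw [integral_const_mul, h0, weylIsometry_apply, weylShift, mul_left_comm, ← Complex.exp_add]
  simp

theorem norm_kernel_sq (w : ℂ) : ‖kernel w‖ ^ 2 = Real.exp (‖w‖ ^ 2) := by
  have h := inner_kernel w (kernel w)
  rw [inner_self_eq_norm_sq_to_K, kernel_apply, fockKernel, Complex.conj_mul'] at h
  refine Complex.ofReal_injective ((Complex.ofReal_pow _ _).trans (h.trans ?_))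
  push_cast
  rfl

theorem kernel_ne_zero (w : ℂ) : kernel w ≠ 0 := by
  intro h
  have := norm_kernel_sq w
  rw [h, norm_zero] at this
  exact (Real.exp_pos _).ne (by simpa using this)

/-- Cauchy–Schwarz against the kernel. This converts norm control into locally uniform control. -/
theorem norm_apply_le (f : FockSpace) (w : ℂ) : ‖f w‖ ≤ ‖f‖ * Real.exp (‖w‖ ^ 2 / 2) := by
  have hk : ‖kernel w‖ = Real.exp (‖w‖ ^ 2 / 2) := by
    rw [← Real.sqrt_sq (norm_nonneg (kernel w)), norm_kernel_sq, Real.exp_half]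
  rw [← inner_kernel, ← hk, mul_comm]
  exact norm_inner_le_norm _ _

theorem norm_eq_eLpNorm (f : FockSpace) : ‖f‖ = (eLpNorm f 2 fockMeasure).toReal := by
  rw [← toReal_enorm]
  congr 1
  refine (ENNReal.pow_right_strictMono two_ne_zero).injective ?_
  simp only [eLpNorm_sq_eq_lintegral, enorm_sq_eq_lintegral]

/-- The embedding of the Fock space into `L²`. -/
def toLp : FockSpace →ₗᵢ[ℂ] Lp ℂ 2 fockMeasure where
  toFun f := f.memLp.toLp
  map_add' _ _ := rfl
  map_smul' _ _ := rfl
  norm_map' f := by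
    rw [norm_eq_eLpNorm]
    exact Lp.norm_toLp _ f.memLp

theorem exists_entire_pointwise_limit {u : ℕ → FockSpace} (hu : CauchySeq u) :
    ∃ f : ℂ → ℂ, Differentiable ℂ f ∧ ∀ z, Tendsto (fun n => u n z) atTop (𝓝 (f z)) := by
  have hc : ∀ z, CauchySeq fun n => u n z := by
    intro z
    rw [Metric.cauchySeq_iff'] at hu ⊢
    intro ε hε
    obtain ⟨N, hN⟩ := hu (ε * (Real.exp (‖z‖ ^ 2 / 2))⁻¹) (by positivity)
    refine ⟨N, fun n hn => ?_⟩
    rw [dist_eq_norm, ← sub_apply]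
    refine (norm_apply_le _ _).trans_lt ?_
    have := hN n hn
    rwa [dist_eq_norm, lt_mul_inv_iff₀ (Real.exp_pos _)] at this
  choose f hf using fun z => cauchySeq_tendsto_of_complete (hc z)
  refine ⟨f, ?_, hf⟩
  have hl : TendstoLocallyUniformlyOn (fun n => (u n : ℂ → ℂ)) f atTop Set.univ := by
    rw [tendstoLocallyUniformlyOn_iff_forall_isCompact isOpen_univ]
    intro K _ hK
    obtain ⟨R, hR⟩ := hK.isBounded.exists_norm_le
    refine UniformCauchySeqOn.tendstoUniformlyOn_of_tendsto ?_ fun z _ => hf z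
    rw [Metric.uniformCauchySeqOn_iff]
    intro ε hε
    rw [Metric.cauchySeq_iff] at hu
    obtain ⟨N, hN⟩ := hu (ε * (Real.exp (R ^ 2 / 2))⁻¹) (by positivity)
    refine ⟨N, fun m hm n hn z hz => ?_⟩
    rw [dist_eq_norm, ← sub_apply]
    refine (norm_apply_le _ _).trans_lt ?_
    have := hN m hm n hn
    rw [dist_eq_norm, lt_mul_inv_iff₀ (Real.exp_pos _)] at this
    refine lt_of_le_of_lt ?_ this
    have := hR z hz
    gcongr
  exact differentiableOn_univ.1 (hl.differentiableOn
    (Eventually.of_forall fun n => (u n).differentiable.differentiableOn) isOpen_univ)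

instance : CompleteSpace FockSpace := by
  refine UniformSpace.complete_of_cauchySeq_tendsto fun u hu => ?_
  obtain ⟨f, hfd, hf⟩ := exists_entire_pointwise_limit hu
  obtain ⟨g, hg⟩ := cauchySeq_tendsto_of_complete (toLp.isometry.uniformContinuous.comp_cauchySeq hu)
  obtain ⟨φ, hφ, hae⟩ := (tendstoInMeasure_of_tendsto_Lp hg).exists_seq_tendsto_ae
  have hu_ae : ∀ᵐ z ∂fockMeasure, ∀ n, toLp (u n) z = u n z :=
    ae_all_iff.2 fun n => (u n).memLp.coeFn_toLp
  -- The `L²` limit and the entire pointwise limit agree along an a.e. convergent subsequence.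
  have hfg : f =ᵐ[fockMeasure] g := by
    filter_upwards [hae, hu_ae] with z hz hz'
    refine tendsto_nhds_unique ((hf z).comp hφ.tendsto_atTop) ?_
    simpa [Function.comp_def, hz'] using hz
  let F : FockSpace := ⟨f, hfd, (Lp.memLp g).ae_eq hfg.symm⟩
  have hF : toLp F = g := Lp.ext (F.memLp.coeFn_toLp.trans hfg)
  refine ⟨F, ?_⟩
  rw [← hF] at hg
  exact toLp.isometry.isEmbedding.tendsto_nhds_iff.2 hg

end FockSpace

/-! ### Compactness of dilations -/

/-- The entire functions in the pointwise unit ball of the Fock space, with the topology of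
locally uniform convergence. -/
def fockMajorized : Set C(ℂ, ℂ) :=
  {f | Differentiable ℂ f ∧ ∀ z, ‖f z‖ ≤ Real.exp (‖z‖ ^ 2 / 2)}

namespace FockSpace

open Filter Topology

theorem isClosed_fockMajorized : IsClosed fockMajorized := by
  refine isClosed_of_closure_subset fun f hf => ?_
  obtain ⟨u, hu, huf⟩ := mem_closure_iff_seq_limit.1 hf
  refine ⟨?_, fun z => ?_⟩
  · have hl := ContinuousMap.tendsto_iff_tendstoLocallyUniformly.1 huf
    exact differentiableOn_univ.1 (hl.tendstoLocallyUniformlyOn.differentiableOn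
      (Eventually.of_forall fun n => (hu n).1.differentiableOn) isOpen_univ)
  · have : Tendsto (fun n => ‖u n z‖) atTop (𝓝 ‖f z‖) :=
      (((continuous_eval_const z).tendsto f).comp huf).norm
    exact le_of_tendsto this (Eventually.of_forall fun n => (hu n).2 z)

theorem equicontinuous_fockMajorized :
    Equicontinuous (fun f : fockMajorized => (f : C(ℂ, ℂ)) : fockMajorized → ℂ → ℂ) := by
  intro c
  let B : ℝ := Real.exp ((‖c‖ + 1) ^ 2 / 2)
  have hB : ∀ f ∈ fockMajorized, ∀ z ∈ Metric.ball c 1, ‖f z‖ ≤ B := by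
    intro f hf z hz
    refine (hf.2 z).trans (Real.exp_le_exp.2 ?_)
    have : ‖z‖ ≤ ‖c‖ + 1 := by
      have := norm_sub_norm_le z c
      have hz' := (mem_ball_iff_norm.1 hz).le
      linarith
    gcongr
  -- Schwarz lemma: on the ball of radius `1` about `c`, `f` stays within `2 * B` of `f c`.
  refine Metric.equicontinuousAt_of_continuity_modulus (fun z => 2 * B / 1 * dist z c) ?_ _ ?_
  · have : Continuous fun z => 2 * B / 1 * dist z c := by fun_prop
    simpa using this.tendsto c
  · filter_upwards [Metric.ball_mem_nhds c one_pos] with z hz f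
    rw [dist_comm]
    refine Complex.dist_le_div_mul_dist_of_mapsTo_ball f.2.1.differentiableOn ?_ hz
    intro w hw
    rw [mem_closedBall_iff_norm, two_mul]
    exact (norm_sub_le _ _).trans
      (add_le_add (hB _ f.2 w hw) (hB _ f.2 c (Metric.mem_ball_self one_pos)))

/-- Montel's theorem for this family, through Arzelà–Ascoli. -/
theorem isCompact_fockMajorized : IsCompact fockMajorized := by
  rw [← isClosed_fockMajorized.closure_eq]
  refine ArzelaAscoli.isCompact_closure_of_isClosedEmbedding (𝔖 := {K : Set ℂ | IsCompact K})
    (F := fun f : C(ℂ, ℂ) => (f : ℂ → ℂ)) (fun K hK => hK) ?_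
    (fun K _ => equicontinuous_fockMajorized.equicontinuousOn K)
    (fun K _ z _ => ⟨_, isCompact_closedBall (0 : ℂ) (Real.exp (‖z‖ ^ 2 / 2)), fun f hf => by
      simpa using hf.2 z⟩)
  refine ⟨ContinuousMap.isUniformEmbedding_toUniformOnFunIsCompact.isEmbedding, ?_⟩
  have := ContinuousMap.range_toUniformOnFunIsCompact (α := ℂ) (β := ℂ)
  change IsClosed (Set.range ContinuousMap.toUniformOnFunIsCompact)
  rw [this]
  exact UniformOnFun.isClosed_setOfPred_continuous CompactlyCoherentSpace.isCoherentWith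

theorem integrable_exp_norm_sq {s : ℝ} (hs : s < 1) :
    Integrable (fun z : ℂ => Real.exp (s * ‖z‖ ^ 2)) fockMeasure := by
  rw [fockMeasure_eq_complexGaussian, complexGaussian,
    integrable_withDensity_iff_integrable_smul' (by fun_prop)
      (Eventually.of_forall fun _ => ENNReal.ofReal_lt_top)]
  refine ((integrable_exp_neg_mul_norm_sq (sub_pos.2 hs)).const_mul Real.pi⁻¹).congr
    (Eventually.of_forall fun z => ?_)
  dsimp only
  rw [ENNReal.toReal_ofReal (gaussianDensity_nonneg one_pos z), gaussianDensity, smul_eq_mul,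
    mul_assoc, ← Real.exp_add]
  ring_nf

variable {a : ℂ}

theorem norm_comp_mul_sq_le {f : C(ℂ, ℂ)} (hf : f ∈ fockMajorized) (a z : ℂ) :
    ‖f (a * z)‖ ^ 2 ≤ Real.exp (‖a‖ ^ 2 * ‖z‖ ^ 2) := by
  calc ‖f (a * z)‖ ^ 2 ≤ Real.exp (‖a * z‖ ^ 2 / 2) ^ 2 := by
        gcongr
        exact hf.2 _
    _ = _ := by
        rw [← Real.exp_nat_mul, norm_mul, mul_pow]
        push_cast
        ring_nf

theorem memLp_comp_mul (ha : ‖a‖ < 1) {f : C(ℂ, ℂ)} (hf : f ∈ fockMajorized) :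
    MemLp (fun z => f (a * z)) 2 fockMeasure := by
  have hc : Continuous fun z => f (a * z) := by fun_prop
  rw [← memLp_norm_iff hc.aestronglyMeasurable, memLp_two_iff_integrable_sq
    hc.norm.aestronglyMeasurable]
  refine (integrable_exp_norm_sq (s := ‖a‖ ^ 2) (by nlinarith [norm_nonneg a])).mono'
    (hc.norm.pow 2).aestronglyMeasurable (Eventually.of_forall fun z => ?_)
  rw [Real.norm_of_nonneg (by positivity)]
  exact norm_comp_mul_sq_le hf a z

/-- The dilation of an entire function of Gaussian growth, as an element of the Fock space. -/
def dilateMajorized (ha : ‖a‖ < 1) (f : fockMajorized) : FockSpace :=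
  ⟨fun z => (f : C(ℂ, ℂ)) (a * z), f.2.1.comp (differentiable_id.const_mul a),
    memLp_comp_mul ha f.2⟩

/-- Dominated convergence: dilation improves the growth of the square to `exp (‖a‖² ‖z‖²)`, which is
integrable because `‖a‖ < 1`. -/
theorem continuous_dilateMajorized (ha : ‖a‖ < 1) : Continuous (dilateMajorized ha) := by
  refine continuous_iff_seqContinuous.2 fun u f hu => ?_
  rw [tendsto_iff_norm_sub_tendsto_zero]
  have hz : ∀ z, Tendsto (fun n => (u n : C(ℂ, ℂ)) z) atTop (𝓝 ((f : C(ℂ, ℂ)) z)) := fun z =>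
    ((continuous_eval_const z).tendsto _).comp ((continuous_subtype_val.tendsto f).comp hu)
  have hsq : Tendsto (fun n => ‖dilateMajorized ha (u n) - dilateMajorized ha f‖ ^ 2) atTop
      (𝓝 0) := by
    simp only [norm_sq_eq_integral]
    rw [← integral_zero ℂ ℝ (μ := fockMeasure)]
    refine tendsto_integral_of_dominated_convergence
      (fun z => 4 * Real.exp (‖a‖ ^ 2 * ‖z‖ ^ 2)) (fun n => ?_)
      ((integrable_exp_norm_sq (by nlinarith [norm_nonneg a])).const_mul 4) (fun n => ?_) ?_
    · exact ((continuous _).norm.pow 2).aestronglyMeasurable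
    · refine Eventually.of_forall fun z => ?_
      rw [Real.norm_of_nonneg (by positivity), sub_apply]
      have h1 := norm_comp_mul_sq_le (u n).2 a z
      have h2 := norm_comp_mul_sq_le f.2 a z
      have h3 := norm_sub_le ((u n : C(ℂ, ℂ)) (a * z)) ((f : C(ℂ, ℂ)) (a * z))
      have h4 := pow_le_pow_left₀ (norm_nonneg _) h3 2
      change ‖(u n : C(ℂ, ℂ)) (a * z) - (f : C(ℂ, ℂ)) (a * z)‖ ^ 2 ≤ _
      nlinarith [sq_nonneg (‖(u n : C(ℂ, ℂ)) (a * z)‖ - ‖(f : C(ℂ, ℂ)) (a * z)‖)]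
    · refine Eventually.of_forall fun z => ?_
      have := (((hz (a * z)).sub_const ((f : C(ℂ, ℂ)) (a * z))).norm).pow 2
      rwa [sub_self, norm_zero, zero_pow two_ne_zero] at this
  have := hsq.sqrt
  simpa [Real.sqrt_sq] using this

/-- The dilation operator `f ↦ f (a ·)` for `|a| < 1`. -/
def dilation (ha : ‖a‖ < 1) : FockSpace →L[ℂ] FockSpace :=
  LinearMap.mkContinuous
    { toFun := fun f => ⟨fun z => f (a * z), f.differentiable.comp (differentiable_id.const_mul a),
        memLp_of_lintegral_le f (f.continuous.comp (continuous_const_mul a))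
          (lintegral_enorm_sq_comp_mul_le ha f.differentiable)⟩
      map_add' := fun _ _ => rfl
      map_smul' := fun _ _ => rfl } 1 fun f => by
    rw [one_mul]
    exact norm_le_of_lintegral_le (lintegral_enorm_sq_comp_mul_le ha f.differentiable)

theorem norm_dilation_le (ha : ‖a‖ < 1) : ‖dilation ha‖ ≤ 1 :=
  LinearMap.mkContinuous_norm_le _ zero_le_one _

theorem isCompactOperator_dilation (ha : ‖a‖ < 1) : IsCompactOperator (dilation ha) := by
  have : CompactSpace fockMajorized := isCompact_iff_compactSpace.1 isCompact_fockMajorized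
  rw [isCompactOperator_iff_exists_mem_nhds_image_subset_compact]
  refine ⟨Metric.closedBall 0 1, Metric.closedBall_mem_nhds _ one_pos, _,
    isCompact_range (continuous_dilateMajorized ha), ?_⟩
  -- The unit ball lies in the Montel-compact family, on which dilation is continuous into the Fock
  -- space.
  rintro _ ⟨f, hf, rfl⟩
  refine ⟨⟨⟨f, f.continuous⟩, f.differentiable, fun z => (norm_apply_le f z).trans ?_⟩, rfl⟩
  exact mul_le_of_le_one_left (Real.exp_pos _).le (by simpa using hf)

end FockSpace

/-! ### Eigenvalues and norms of weighted composition operators -/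

theorem ContinuousLinearMap.spectralRadius_le_nnnorm_of_nontrivial {E : Type*}
    [NormedAddCommGroup E] [NormedSpace ℂ E] [CompleteSpace E] [Nontrivial E] (T : E →L[ℂ] E) :
    spectralRadius ℂ T ≤ ‖T‖₊ :=
  spectrum.spectralRadius_le_nnnorm T

namespace FockSpace

open Filter Topology

variable {ψ φ : ℂ → ℂ} {T : FockSpace →L[ℂ] FockSpace}

/-- Equality case of Cauchy–Schwarz: expanding `‖T K_p - ψ p • K_p‖²` leaves at most `0`. -/
theorem eq_of_map_kernel {p : ℂ} (hp : φ p = p) (hT : IsWeightedCompositionOperator ψ φ T)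
    (hn : ‖T‖ ≤ ‖ψ p‖) : T (kernel p) = ψ p • kernel p := by
  have hin : inner ℂ (kernel p) (T (kernel p)) = ψ p * inner ℂ (kernel p) (kernel p) := by
    rw [inner_kernel, inner_kernel, hT, weightedComp, hp]
  have hre : RCLike.re (inner ℂ (T (kernel p)) (ψ p • kernel p)) = ‖ψ p‖ ^ 2 * ‖kernel p‖ ^ 2 := by
    rw [← inner_conj_symm, RCLike.conj_re, inner_smul_left, hin, ← mul_assoc, Complex.conj_mul',
      inner_self_eq_norm_sq_to_K]
    change Complex.re ((‖ψ p‖ : ℂ) ^ 2 * (‖kernel p‖ : ℂ) ^ 2) = _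
    rw [← Complex.ofReal_pow, ← Complex.ofReal_pow, ← Complex.ofReal_mul, Complex.ofReal_re]
  have hle : ‖T (kernel p)‖ ^ 2 ≤ (‖ψ p‖ * ‖kernel p‖) ^ 2 :=
    pow_le_pow_left₀ (norm_nonneg _) ((T.le_opNorm _).trans (by gcongr)) 2
  have h := norm_sub_sq (𝕜 := ℂ) (T (kernel p)) (ψ p • kernel p)
  rw [hre, norm_smul] at h
  have h0 : ‖T (kernel p) - ψ p • kernel p‖ ^ 2 ≤ 0 := by
    rw [h]
    linarith
  exact sub_eq_zero.1 (norm_eq_zero.1 (pow_eq_zero_iff two_ne_zero |>.1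
    (le_antisymm h0 (by positivity))))

/-- The eigenvalues of a weighted composition operator whose symbol contracts to `p` are bounded
by the modulus of the weight at `p`. -/
theorem norm_eigenvalue_le {a p μ : ℂ} (ha : ‖a‖ < 1) (hψ : Continuous ψ) {f : ℂ → ℂ}
    (hf : Differentiable ℂ f) (hf0 : f ≠ 0) (h : ∀ z, ψ z * f (a * (z - p) + p) = μ * f z) :
    ‖μ‖ ≤ ‖ψ p‖ := by
  have hfa : AnalyticOnNhd ℂ f Set.univ := fun z _ => hf.analyticAt z
  have hne : ¬ ∀ᶠ z in 𝓝 p, f z = 0 := fun hev =>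
    hf0 (hfa.eq_of_eventuallyEq analyticOnNhd_const hev)
  obtain ⟨n, g, hg, hgp, hfg⟩ :=
    (hf.analyticAt p).exists_eventuallyEq_pow_smul_nonzero_iff.2 hne
  have hmap : Tendsto (fun z => a * (z - p) + p) (𝓝 p) (𝓝 p) := by
    have : Continuous fun z => a * (z - p) + p := by fun_prop
    simpa using this.tendsto p
  -- Off `p` the common factor `(z - p) ^ n` cancels; letting `z → p` then gives `μ = ψ p * a ^ n`.
  have hev : ∀ᶠ z in 𝓝[≠] p, ψ z * (a ^ n * g (a * (z - p) + p)) = μ * g z := by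
    filter_upwards [hfg.filter_mono nhdsWithin_le_nhds,
      (hmap.eventually hfg).filter_mono nhdsWithin_le_nhds, self_mem_nhdsWithin] with z h1 h2 hz
    have hzp : (z - p) ^ n ≠ 0 := pow_ne_zero _ (sub_ne_zero.2 hz)
    have := h z
    rw [h1, h2, add_sub_cancel_right, mul_pow, smul_eq_mul, smul_eq_mul] at this
    refine mul_left_cancel₀ hzp ?_
    linear_combination this
  have hl : Tendsto (fun z => ψ z * (a ^ n * g (a * (z - p) + p))) (𝓝[≠] p)
      (𝓝 (ψ p * (a ^ n * g p))) :=
    ((hψ.tendsto p).mul ((hg.continuousAt.tendsto.comp hmap).const_mul _)).mono_left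
      nhdsWithin_le_nhds
  have hr : Tendsto (fun z => μ * g z) (𝓝[≠] p) (𝓝 (μ * g p)) :=
    (hg.continuousAt.tendsto.const_mul _).mono_left nhdsWithin_le_nhds
  have heq := tendsto_nhds_unique (hl.congr' hev) hr
  rw [← mul_assoc] at heq
  rw [← mul_right_cancel₀ hgp heq, norm_mul, norm_pow]
  exact mul_le_of_le_one_right (norm_nonneg _) (pow_le_one₀ (norm_nonneg _) ha.le)

theorem spectralRadius_le {a p : ℂ} (ha : ‖a‖ < 1) (hψ : Continuous ψ)
    (hT : IsWeightedCompositionOperator ψ (fun z => a * (z - p) + p) T)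
    (hc : IsCompactOperator T) : spectralRadius ℂ T ≤ ‖ψ p‖₊ := by
  refine iSup₂_le fun μ hμ => ?_
  rcases eq_or_ne μ 0 with rfl | hμ0
  · simp
  obtain ⟨f, hf⟩ := ((hc.hasEigenvalue_iff_mem_spectrum hμ0).2 hμ).exists_hasEigenvector
  have hTf : T f = μ • f := hf.apply_eq_smul
  refine ENNReal.coe_le_coe.2 (norm_eigenvalue_le ha hψ f.differentiable
    (fun h0 => hf.2 (ext (congrFun h0))) fun z => ?_)
  have := congrFun (hT f) z
  rw [hTf] at this
  exact this.symm

/-- The explicit weight for which the operator is a multiple of a Weyl conjugate of a dilation. -/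
theorem isWeightedCompositionOperator_conj_dilation {a : ℂ} (ha : ‖a‖ < 1) (c p : ℂ) :
    IsWeightedCompositionOperator (fun z => c * Complex.exp (conj p * (1 - a) * (z - p)))
      (fun z => a * (z - p) + p)
      (c • (weylIsometry (-p)).toContinuousLinearMap ∘L dilation ha ∘L
        (weylIsometry p).toContinuousLinearMap) := by
  intro f
  funext z
  change c * weylShift (-p) (fun u => weylShift p f (a * u)) z = _
  simp only [weylShift, weightedComp]
  rw [mul_assoc c, mul_comm (Complex.exp _), mul_assoc (f _), ← Complex.exp_add, ← sub_eq_add_neg]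
  congr 3
  have := Complex.conj_mul' p
  simp only [map_neg, norm_neg]
  linear_combination this

theorem norm_conj_dilation_le {a : ℂ} (ha : ‖a‖ < 1) (c p : ℂ) :
    ‖c • (weylIsometry (-p)).toContinuousLinearMap ∘L dilation ha ∘L
        (weylIsometry p).toContinuousLinearMap‖ ≤ ‖c‖ := by
  refine ContinuousLinearMap.opNorm_le_bound _ (norm_nonneg _) fun f => ?_
  change ‖c • weylIsometry (-p) (dilation ha (weylIsometry p f))‖ ≤ _
  rw [norm_smul, LinearIsometry.norm_map]
  refine mul_le_mul_of_nonneg_left ?_ (norm_nonneg _)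
  calc _ ≤ 1 * ‖weylIsometry p f‖ := (dilation ha).le_of_opNorm_le (norm_dilation_le ha) _
    _ = ‖f‖ := by rw [one_mul, LinearIsometry.norm_map]

end FockSpace

end

/-! ### The characterization -/

open FockSpace

theorem corollary2p5 (ψ : ℂ → ℂ) (hψ : Differentiable ℂ ψ) (hψ0 : ψ ≠ 0)
    (a b : ℂ) (ha : ‖a‖ < 1) :
    (∃ T : FockSpace →L[ℂ] FockSpace,
        IsWeightedCompositionOperator ψ (fun z => a * z + b) T ∧
          IsCompactOperator T ∧ IsNormaloid T) ↔
      ψ = fun z => ψ 0 * fockKernel (b * ((conj a - 1) / (a - 1))) z := by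
  have ha1 : a - 1 ≠ 0 := sub_ne_zero.2 fun h => by simp [h] at ha
  have ha1' : conj a - 1 ≠ 0 := by simpa using (map_ne_zero (starRingEnd ℂ)).2 ha1
  obtain ⟨p, hp⟩ : ∃ p, p = b / (1 - a) := ⟨_, rfl⟩
  have hb : b = p * (1 - a) := by
    rw [hp, div_mul_cancel₀ _ (by rwa [← neg_ne_zero, neg_sub])]
  have hφ : (fun z => a * z + b) = fun z => a * (z - p) + p := by
    funext z
    rw [hb]
    ring
  have hw : ∀ z, fockKernel (b * ((conj a - 1) / (a - 1))) z =
      Complex.exp (conj p * (1 - a) * z) := by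
    intro z
    rw [fockKernel, hb]
    congr 2
    simp only [map_mul, map_div₀, map_sub, map_one, Complex.conj_conj]
    field_simp
    ring
  simp only [hφ, hw]
  constructor
  · rintro ⟨T, hT, hc, hn⟩
    have hle : ‖T‖ ≤ ‖ψ p‖ := by
      have := spectralRadius_le ha hψ.continuous hT hc
      rw [← hn] at this
      exact ENNReal.coe_le_coe.1 this
    have hk := eq_of_map_kernel (by simp) hT hle
    have hψp : ∀ z, ψ z = ψ p * Complex.exp (conj p * (1 - a) * (z - p)) := by
      intro z
      have h := congrFun (hT (kernel p)) z
      rw [hk] at h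
      change ψ p * kernel p z = ψ z * kernel p _ at h
      rw [kernel_apply, kernel_apply, fockKernel, fockKernel] at h
      -- The factor cancelled is `K_p` at the image of `z`; it never vanishes, so the eigenvector
      -- equation determines `ψ`.
      refine mul_right_cancel₀ (Complex.exp_ne_zero (conj p * (a * (z - p) + p))) ?_
      rw [← h, mul_assoc, ← Complex.exp_add]
      ring_nf
    funext z
    rw [hψp z, hψp 0, mul_assoc (ψ p), ← Complex.exp_add]
    ring_nf
  · intro h
    have hψp : ψ = fun z => ψ p * Complex.exp (conj p * (1 - a) * (z - p)) := by
      funext z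
      rw [congrFun h z, congrFun h p, mul_assoc (ψ 0), ← Complex.exp_add]
      ring_nf
    let T := ψ p • (weylIsometry (-p)).toContinuousLinearMap ∘L dilation ha ∘L
        (weylIsometry p).toContinuousLinearMap
    have hT : IsWeightedCompositionOperator ψ (fun z => a * (z - p) + p) T := by
      have := isWeightedCompositionOperator_conj_dilation ha (ψ p) p
      rwa [← hψp] at this
    have hn : ‖T‖ ≤ ‖ψ p‖ := norm_conj_dilation_le ha (ψ p) p
    have hk : T (kernel p) = ψ p • kernel p := eq_of_map_kernel (by simp) hT hn
    refine ⟨T, hT, ?_, ?_⟩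
    · exact (((isCompactOperator_dilation ha).comp_clm
        (weylIsometry p).toContinuousLinearMap).clm_comp
        (weylIsometry (-p)).toContinuousLinearMap).smul (ψ p)
    · have : Nontrivial FockSpace := nontrivial_of_ne _ _ (kernel_ne_zero 0)
      refine le_antisymm ?_ T.spectralRadius_le_nnnorm_of_nontrivial
      -- The eigenvalue `ψ p` bounds the spectral radius below by `|ψ p|`, hence by `‖T‖`.
      have hev : Module.End.HasEigenvector (T : Module.End ℂ FockSpace) (ψ p) (kernel p) :=
        ⟨Module.End.mem_eigenspace_iff.2 hk, kernel_ne_zero p⟩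
      have hmem : ψ p ∈ spectrum ℂ T := by
        rw [ContinuousLinearMap.spectrum_eq]
        exact (Module.End.hasEigenvalue_of_hasEigenvector hev).mem_spectrum
      exact (ENNReal.coe_le_coe.2 hn).trans
        (le_iSup₂ (f := fun k (_ : k ∈ spectrum ℂ T) => (‖k‖₊ : ℝ≥0∞)) (ψ p) hmem)
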